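/- Let $k$ be an infinite field, let $S=k[x_0,\dots,x_n]$ with homogeneous maximal ideal $\mathfrak m=(x_0,\dots,x_n)$, let $W\subset S$ be an $(r+1)$-dimensional $k$-vector space ($r\ge 0$) of forms of the same degree $d$, and let $I\subset S$ be the ideal generated by $W$. Assume that $I$ has codimension at least $2$. Let $\ell(I)$ denote the analytic spread of $I$, that is, the Krull dimension of the special fiber ring $S[It]/\mathfrak m S[It]$ (equivalently, one plus the dimension of the image of the rational map $\phi:\mathbf P^n\dashrightarrow \mathbf P^r=\mathbf P(W)$ defined by $W$). A homogeneous presentation of $I$ is a homogeneous free presentation $F\to G\to I\to 0$ with respect to a homogeneous minimal generating set of $I$; after a choice of homogeneous bases it is given by a matrix whose rows are indexed by the generators, and a row ideal is the ideal generated by the entries of one row. Then there are a basis $b_0,\dots,b_r$ of $W$ and a homogeneous presentation matrix $A$ of $I$ with respect to the minimal generators $b_0,\dots,b_r$, with finitely many columns, such that 1. each row of $A$ corresponds to the image under $\phi$ of a $k$-rational point outside the exceptional locus $V(I)$: for every $i$ there is a $k$-rational point $p\in\mathbf P^n\setminus V(I)$ for which the span of the $b_j$ with $j\neq i$ is the subspace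 $W_{\phi(p)}=\{w\in W: w(p)=0\}$ of $W$; 2. every row ideal of $A$ has codimension at most $\ell(I)-1$. -/

import Mathlib

namespace RowIdeals

/-- The homogeneous maximal ideal `(x₀, …, xₙ)` of `k[x₀, …, xₙ]`. -/
noncomputable def homogeneousMaximalIdeal (k : Type*) [Field k] (n : ℕ) :
    Ideal (MvPolynomial (Fin (n + 1)) k) :=
  Ideal.span (Set.range MvPolynomial.X)

/-- The special fiber ring `R(I) / m R(I) = ⊕ Iʲ / m Iʲ` of an ideal `I` of `k[x₀, …, xₙ]`,
where `R(I) = S[It]` is the Rees algebra and `m` the homogeneous maximal ideal. -/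
abbrev SpecialFiberRing {k : Type*} [Field k] {n : ℕ}
    (I : Ideal (MvPolynomial (Fin (n + 1)) k)) : Type _ :=
  reesAlgebra I ⧸ (homogeneousMaximalIdeal k n).map
    (algebraMap (MvPolynomial (Fin (n + 1)) k) (reesAlgebra I))

/-- The analytic spread `ℓ(I)`: the Krull dimension of the special fiber ring. -/
noncomputable def analyticSpread {k : Type*} [Field k] {n : ℕ}
    (I : Ideal (MvPolynomial (Fin (n + 1)) k)) : WithBot ℕ∞ :=
  ringKrullDim (SpecialFiberRing I)

/-- `A` is the matrix of a homogeneous free presentation `F → G → I → 0` with respect to the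
homogeneous minimal generating set `g` of `I`. Here `G` has a basis indexed by `ι`, mapped to `g`,
and `F` a basis indexed by `κ`; the columns of `A` are the images of the basis elements of `F`,
and the rows of `A` correspond to the generators. -/
structure IsHomogeneousPresentation {σ k ι κ : Type*} [Field k] [Fintype ι] [Fintype κ]
    (I : Ideal (MvPolynomial σ k)) (g : ι → MvPolynomial σ k)
    (A : Matrix ι κ (MvPolynomial σ k)) : Prop where
  /-- the `g i` generate `I` -/
  span_eq : Ideal.span (Set.range g) = I
  /-- no `g i` can be omitted -/
  minimal : ∀ i, g i ∉ Ideal.span (g '' {i}ᶜ)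
  /-- there are degrees `a i` of the basis elements of `G` and `e j` of those of `F` for which
  both maps are homogeneous of degree `0` -/
  homogeneous : ∃ (a : ι → ℕ) (e : κ → ℕ), (∀ i, (g i).IsHomogeneous (a i)) ∧
    ∀ i j, A i j = 0 ∨ ∃ c, e j = a i + c ∧ (A i j).IsHomogeneous c
  /-- the columns of `A` generate the module of syzygies of `g` -/
  exact : LinearMap.range A.mulVecLin =
    LinearMap.ker (Fintype.linearCombination (MvPolynomial σ k) g)

/-- The ideal generated by the entries of the `i`-th row of a matrix. -/
def rowIdeal {R ι κ : Type*} [CommRing R] (A : Matrix ι κ R) (i : ι) : Ideal R :=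
  Ideal.span (Set.range (A i))

/-- The set of `k`-rational points of `V(I)` in projective space, for a homogeneous ideal `I`.
If `I` is generated by a space `W` of forms of the same degree, this is the exceptional locus of
the rational map defined by `W`. (Vanishing of forms does not depend on the representative.) -/
def zeroLocus {k : Type*} [Field k] {n : ℕ} (I : Ideal (MvPolynomial (Fin (n + 1)) k)) :
    Set (Projectivization k (Fin (n + 1) → k)) :=
  {p | ∀ f ∈ I, MvPolynomial.eval p.rep f = 0}

/-- The image `φ(p)` of a point `p` under the rational map `φ` to `ℙ(W)` defined by a space `W` of
forms of the same degree. A rational point `q` of `ℙ(W)` is a subspace `W_q` of codimension `1`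
of `W`; for `φ(p)` it consists of the forms in `W` vanishing at `p`
(and it has codimension `1` exactly if `p` is outside of the exceptional locus). -/
noncomputable def imagePoint {k : Type*} [Field k] {n : ℕ}
    (W : Submodule k (MvPolynomial (Fin (n + 1)) k))
    (p : Projectivization k (Fin (n + 1) → k)) : Submodule k (MvPolynomial (Fin (n + 1)) k) :=
  W ⊓ LinearMap.ker (MvPolynomial.aeval (R := k) p.rep).toLinearMap

/-- The point of `ℙ(W)` to which the `i`-th row of a presentation matrix with respect to the basis
`b` of `W` corresponds: that row is the composition of `F → G = S ⊗ W` with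
`S ⊗ W → S ⊗ (W / W_q)`, where `W_q` is spanned by the `b j` with `j ≠ i`. -/
noncomputable def rowPoint {k : Type*} [Field k] {n : ℕ} {ι : Type*}
    {W : Submodule k (MvPolynomial (Fin (n + 1)) k)} (b : Module.Basis ι k W) (i : ι) :
    Submodule k (MvPolynomial (Fin (n + 1)) k) :=
  Submodule.span k ((fun j => (b j : MvPolynomial (Fin (n + 1)) k)) '' {i}ᶜ)

end RowIdeals

open scoped Polynomial

/-!
Let `R = k[bᵢ t] ⊆ S[t]`, the homogeneous coordinate ring of the image of `φ`; since the `bᵢ` are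
forms of the same degree, it is isomorphic to the special fiber ring, so `dim R = ℓ(I)`. Rational
points impose enough linear conditions on `W` that some basis `b` of `W` is dual to evaluation at
points `p₀, …, pᵣ`.

A relation `∑ aⱼ bⱼ = 0` shows that a prime ideal containing all `bⱼ` with `j ≠ i`, but not `bᵢ`,
contains the `i`-th row ideal. The ideal of the point `pᵢ` is such a prime, but it is too high.
Its extension to `S[t]` contracts to a prime `𝔭` of `R` which is not maximal. A prime of `S[t]`
minimal over `𝔞 S[t]`, where `𝔭` is minimal over an ideal `𝔞` of `R` with `height 𝔭`
generators, has height at most `height 𝔭 ≤ dim R - 1`; it can be chosen to contract to `𝔭` too,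
and its contraction to `S` is the required prime.
-/

namespace RowIdeals

section Height

variable {R S : Type*} [CommRing R] [CommRing S] [IsNoetherianRing R]

theorem exists_isPrime_le_comap_eq_height_le [IsNoetherianRing S] (f : R →+* S) (P : Ideal S)
    [P.IsPrime] :
    ∃ Q : Ideal S, Q.IsPrime ∧ Q ≤ P ∧ Q.comap f = P.comap f ∧ Q.height ≤ (P.comap f).height := by
  classical
  obtain ⟨s, hs, hcard⟩ := (P.comap f).exists_finset_card_eq_height_of_isNoetherianRing
  have hle : Ideal.span (s.image f : Set S) ≤ P := by
    rw [Finset.coe_image, ← Ideal.map_span, Ideal.map_le_iff_le_comap]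
    exact hs.1.2
  obtain ⟨Q, hQ, hQP⟩ := Ideal.exists_minimalPrimes_le hle
  have hQprime : Q.IsPrime := hQ.1.1
  have hspan : Ideal.span s ≤ Q.comap f := by
    rw [← Ideal.map_le_iff_le_comap, Ideal.map_span, ← Finset.coe_image]
    exact hQ.1.2
  refine ⟨Q, hQprime, hQP, (Ideal.comap_mono hQP).antisymm
    (hs.2 ⟨inferInstance, hspan⟩ (Ideal.comap_mono hQP)), ?_⟩
  calc Q.height ≤ (s.image f).card := Ideal.height_le_card_of_mem_minimalPrimes_span_finset hQ
    _ ≤ s.card := by exact_mod_cast Finset.card_image_le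
    _ = (P.comap f).height := hcard

theorem height_comap_C_le (Q : Ideal R[X]) [Q.IsPrime] :
    (Q.comap Polynomial.C).height ≤ Q.height := by
  have : Q.LiesOver (Q.comap Polynomial.C) := ⟨rfl⟩
  rw [Ideal.height_eq_height_add_of_liesOver_of_hasGoingDown (Q.comap Polynomial.C) Q]
  exact le_self_add

theorem monomial_one_mem_map_C_iff {P : Ideal S} {a : S} :
    Polynomial.monomial 1 a ∈ P.map Polynomial.C ↔ a ∈ P := by
  refine ⟨fun h => by simpa using Ideal.mem_map_C_iff.1 h 1, fun h => ?_⟩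
  rw [← Polynomial.C_mul_X_eq_monomial]
  exact Ideal.mul_mem_right _ _ (Ideal.mem_map_of_mem _ h)

theorem height_comap_map_C_add_one_le_ringKrullDim {A : Type*} [CommRing A] (f : A →+* S[X])
    (P : Ideal S) [P.IsPrime] {x : A} {a : S} (hx : f x = Polynomial.monomial 1 a) (ha : a ∉ P) :
    (((P.map Polynomial.C).comap f).height : WithBot ℕ∞) + 1 ≤ ringKrullDim A := by
  let P₀ : Ideal S[X] := P.comap Polynomial.constantCoeff
  have hle : P.map Polynomial.C ≤ P₀ :=
    Ideal.map_le_iff_le_comap.2 fun c hc => by simpa [P₀] using hc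
  have hx₀ : x ∈ P₀.comap f := by simp [P₀, hx]
  have hlt : (P.map Polynomial.C).comap f < P₀.comap f :=
    (Ideal.comap_mono hle).lt_of_ne fun h =>
      ha (monomial_one_mem_map_C_iff.1 (hx ▸ Ideal.mem_comap.1 (h ▸ hx₀)))
  calc (((P.map Polynomial.C).comap f).height : WithBot ℕ∞) + 1 ≤ (P₀.comap f).height := by
        exact_mod_cast Ideal.height_add_one_le_of_lt_of_isPrime hlt
    _ ≤ ringKrullDim A := Ideal.height_le_ringKrullDim_of_isPrime

end Height

section ImageCoordinateRing

variable (k : Type*) {S ι : Type*} [CommRing k] [CommRing S] [Algebra k S]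

/-- The subalgebra `k[gᵢ t]` of `S[t]`. If the `gᵢ` are forms of the same degree in a polynomial
ring `S` over a field `k`, it is the homogeneous coordinate ring of the closure of the image of the
rational map they define; the variable `t` provides the grading also if the `gᵢ` are constants. -/
noncomputable def imageCoordinateRing (g : ι → S) : Subalgebra k S[X] :=
  Algebra.adjoin k (Set.range fun i => Polynomial.monomial 1 (g i))

instance [IsNoetherianRing k] [Finite ι] (g : ι → S) :
    IsNoetherianRing (imageCoordinateRing k g) :=
  isNoetherianRing_of_fg (Subalgebra.fg_def.2 ⟨_, Set.finite_range _, rfl⟩)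

variable {k} in
theorem monomial_one_mem_imageCoordinateRing (g : ι → S) (i : ι) :
    Polynomial.monomial 1 (g i) ∈ imageCoordinateRing k g :=
  Algebra.subset_adjoin ⟨i, rfl⟩

theorem exists_isPrime_height_add_one_le_ringKrullDim [IsNoetherianRing k] [IsNoetherianRing S]
    [Finite ι] (g : ι → S) (P : Ideal S) [P.IsPrime] {i : ι} (hi : g i ∉ P) :
    ∃ Q : Ideal S, Q.IsPrime ∧ (∀ j, g j ∈ Q ↔ g j ∈ P) ∧
      (Q.height : WithBot ℕ∞) + 1 ≤ ringKrullDim (imageCoordinateRing k g) := by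
  let f : imageCoordinateRing k g →+* S[X] := (imageCoordinateRing k g).subtype
  let y (j : ι) : imageCoordinateRing k g := ⟨_, monomial_one_mem_imageCoordinateRing g j⟩
  obtain ⟨Q, hQ, hQP, hcomap, hheight⟩ :=
    exists_isPrime_le_comap_eq_height_le f (P.map Polynomial.C)
  have hX : Polynomial.X ∉ Q := fun h =>
    ‹P.IsPrime›.one_notMem (monomial_one_mem_map_C_iff.1 (hQP h))
  refine ⟨Q.comap Polynomial.C, inferInstance, fun j => ?_, ?_⟩
  · calc Polynomial.C (g j) ∈ Q ↔ Polynomial.C (g j) * Polynomial.X ∈ Q :=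
          ⟨fun h => Q.mul_mem_right _ h, fun h => (hQ.mem_or_mem h).resolve_right hX⟩
      _ ↔ y j ∈ Q.comap f := by rw [Polynomial.C_mul_X_eq_monomial]; rfl
      _ ↔ y j ∈ (P.map Polynomial.C).comap f := by rw [hcomap]
      _ ↔ g j ∈ P := monomial_one_mem_map_C_iff
  · have hle : (Q.comap Polynomial.C).height ≤ ((P.map Polynomial.C).comap f).height :=
      (height_comap_C_le Q).trans hheight
    refine le_trans ?_ (height_comap_map_C_add_one_le_ringKrullDim f P (x := y i) rfl hi)
    exact add_le_add_left (WithBot.coe_le_coe.2 hle) 1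

theorem rowIdeal_le_of_isPrime {κ : Type*} [Fintype ι] [Fintype κ] {g : ι → S} {A : Matrix ι κ S}
    (hA : LinearMap.range A.mulVecLin ≤ LinearMap.ker (Fintype.linearCombination S g))
    {Q : Ideal S} [Q.IsPrime] {i : ι} (hQ : ∀ j, g j ∈ Q ↔ j ≠ i) :
    rowIdeal A i ≤ Q := by
  classical
  rw [rowIdeal, Ideal.span_le]
  rintro _ ⟨l, rfl⟩
  have hsyz : ∑ j, A j l * g j = 0 := by
    simpa [Fintype.linearCombination_apply] using hA ⟨Pi.single l 1, rfl⟩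
  rw [← Finset.add_sum_erase _ _ (Finset.mem_univ i)] at hsyz
  have hmem : A i l * g i ∈ Q := by
    rw [eq_neg_of_add_eq_zero_left hsyz]
    exact Q.neg_mem (Ideal.sum_mem _ fun j hj =>
      Q.mul_mem_left _ ((hQ j).2 (Finset.ne_of_mem_erase hj)))
  exact (‹Q.IsPrime›.mem_or_mem hmem).resolve_right fun h => (hQ i).1 h rfl

theorem height_rowIdeal_add_one_le_ringKrullDim {κ : Type*} [IsNoetherianRing k]
    [IsNoetherianRing S] [Fintype ι] [Fintype κ] {g : ι → S} {A : Matrix ι κ S}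
    (hA : LinearMap.range A.mulVecLin ≤ LinearMap.ker (Fintype.linearCombination S g))
    {P : Ideal S} [P.IsPrime] {i : ι} (hP : ∀ j, g j ∈ P ↔ j ≠ i) :
    ((rowIdeal A i).height : WithBot ℕ∞) + 1 ≤ ringKrullDim (imageCoordinateRing k g) := by
  obtain ⟨Q, hQ, hQP, hheight⟩ :=
    exists_isPrime_height_add_one_le_ringKrullDim k g P (i := i) fun h => (hP i).1 h rfl
  have hle : (rowIdeal A i).height ≤ Q.height :=
    Ideal.height_mono (rowIdeal_le_of_isPrime hA fun j => (hQP j).trans (hP j))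
  exact (add_le_add_left (WithBot.coe_le_coe.2 hle) 1).trans hheight

end ImageCoordinateRing

section ReesAlgebra

variable {S ι : Type*} [CommRing S]

theorem adjoin_range_monomial_one_eq_reesAlgebra (g : ι → S) :
    Algebra.adjoin S (Set.range fun i => Polynomial.monomial 1 (g i)) =
      reesAlgebra (Ideal.span (Set.range g)) := by
  rw [← adjoin_monomial_eq_reesAlgebra, Ideal.span, Submodule.map_span, Algebra.adjoin_span,
    ← Set.range_comp]
  rfl

theorem imageCoordinateRing_le_reesAlgebra {k : Type*} [CommRing k] [Algebra k S] (g : ι → S) :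
    imageCoordinateRing k g ≤ (reesAlgebra (Ideal.span (Set.range g))).restrictScalars k := by
  rw [← adjoin_range_monomial_one_eq_reesAlgebra]
  exact Algebra.adjoin_le Algebra.subset_adjoin

theorem coeff_mem_pow_of_mem_map_reesAlgebra {I J : Ideal S} {d : ℕ} (hI : I ≤ J ^ d)
    {x : reesAlgebra I} (hx : x ∈ J.map (algebraMap S (reesAlgebra I))) (j : ℕ) :
    (x : S[X]).coeff j ∈ J ^ (d * j + 1) := by
  rw [Ideal.map] at hx
  induction hx using Submodule.span_induction generalizing j with
  | mem x hx =>
    obtain ⟨s, hs, rfl⟩ := hx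
    change (Polynomial.C s).coeff j ∈ _
    rw [Polynomial.coeff_C]
    split_ifs with h
    · simpa [h] using hs
    · exact Ideal.zero_mem _
  | zero => simp
  | add x y _ _ hx hy => exact Ideal.add_mem _ (hx j) (hy j)
  | smul a x _ hx =>
    rw [smul_eq_mul, Subalgebra.coe_mul, Polynomial.coeff_mul]
    refine Ideal.sum_mem _ fun ⟨p, q⟩ hpq => ?_
    rw [← Finset.HasAntidiagonal.mem_antidiagonal.1 hpq, mul_add, add_assoc, pow_add, pow_mul]
    exact Ideal.mul_mem_mul (Ideal.pow_right_mono hI p (a.2 p)) (hx q)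

end ReesAlgebra

section Forms

variable {σ k ι : Type*}

theorem eval_smul_of_isHomogeneous [CommSemiring k] {f : MvPolynomial σ k} {d : ℕ}
    (hf : f.IsHomogeneous d) (a : k) (v : σ → k) :
    MvPolynomial.eval (a • v) f = a ^ d * MvPolynomial.eval v f := by
  rw [MvPolynomial.eval_eq, MvPolynomial.eval_eq, Finset.mul_sum]
  refine Finset.sum_congr rfl fun x hx => ?_
  simp only [Pi.smul_apply, smul_eq_mul, mul_pow, Finset.prod_mul_distrib,
    Finset.prod_pow_eq_pow_sum, ← hf.degree_eq_sum_deg_support hx]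
  ring

theorem mem_pow_idealOfVars_of_isHomogeneous [CommSemiring k] {f : MvPolynomial σ k} {d : ℕ}
    (hf : f.IsHomogeneous d) : f ∈ MvPolynomial.idealOfVars σ k ^ d :=
  (MvPolynomial.mem_pow_idealOfVars_iff d f).2 fun _ hx => (hf.degree_eq_sum_deg_support hx).le

theorem eq_zero_of_isHomogeneous_of_mem_pow_idealOfVars [CommSemiring k] {f : MvPolynomial σ k}
    {d : ℕ} (hf : f.IsHomogeneous d) (h : f ∈ MvPolynomial.idealOfVars σ k ^ (d + 1)) :
    f = 0 := by
  ext x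
  by_cases hx : x.degree = d
  · exact (MvPolynomial.mem_pow_idealOfVars_iff' _ f).1 h x (by lia)
  · exact hf.coeff_eq_zero hx

theorem sub_C_coeff_zero_mem_idealOfVars [CommRing k] (f : MvPolynomial σ k) :
    f - MvPolynomial.C (f.coeff 0) ∈ MvPolynomial.idealOfVars σ k := by
  rw [← pow_one (MvPolynomial.idealOfVars σ k), MvPolynomial.mem_pow_idealOfVars_iff']
  intro x hx
  obtain rfl : x = 0 := by rwa [Nat.lt_one_iff, Finsupp.degree_eq_zero_iff] at hx
  simp

theorem isHomogeneous_coeff_of_mem_imageCoordinateRing [CommRing k] {d : ℕ}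
    {g : ι → MvPolynomial σ k} (hg : ∀ i, (g i).IsHomogeneous d) {f : (MvPolynomial σ k)[X]}
    (hf : f ∈ imageCoordinateRing k g) (j : ℕ) : (f.coeff j).IsHomogeneous (d * j) := by
  induction hf using Algebra.adjoin_induction generalizing j with
  | mem x hx =>
    obtain ⟨i, rfl⟩ := hx
    rw [Polynomial.coeff_monomial]
    split_ifs with h
    · simpa [← h] using hg i
    · exact MvPolynomial.isHomogeneous_zero _ _ _
  | algebraMap a =>
    rw [Polynomial.algebraMap_apply, Polynomial.coeff_C]
    split_ifs with h
    · simpa [h] using MvPolynomial.isHomogeneous_C σ a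
    · exact MvPolynomial.isHomogeneous_zero _ _ _
  | add x y _ _ hx hy => exact (hx j).add (hy j)
  | mul x y _ _ hx hy =>
    rw [Polynomial.coeff_mul]
    refine MvPolynomial.IsHomogeneous.sum _ _ _ fun ⟨p, q⟩ hpq => ?_
    rw [← Finset.HasAntidiagonal.mem_antidiagonal.1 hpq, mul_add]
    exact (hx p).mul (hy q)

end Forms

section SpecialFiberRing

variable {k ι : Type*} [Field k] {n : ℕ}

/-- The canonical map from `k[gᵢ t]` through the Rees algebra to the special fiber ring of the ideal
generated by the `gᵢ`. It identifies the special fiber ring with the homogeneous coordinate ring of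
the image of the rational map if the `gᵢ` are forms of the same degree. -/
noncomputable def toSpecialFiberRing (g : ι → MvPolynomial (Fin (n + 1)) k) :
    imageCoordinateRing k g →+* SpecialFiberRing (Ideal.span (Set.range g)) :=
  (Ideal.Quotient.mk _).comp
    (Subalgebra.inclusion (imageCoordinateRing_le_reesAlgebra (k := k) g)).toRingHom

theorem toSpecialFiberRing_injective {d : ℕ} {g : ι → MvPolynomial (Fin (n + 1)) k}
    (hg : ∀ i, (g i).IsHomogeneous d) : Function.Injective (toSpecialFiberRing g) := by
  have hI : Ideal.span (Set.range g) ≤ homogeneousMaximalIdeal k n ^ d := by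
    rw [Ideal.span_le]
    rintro _ ⟨i, rfl⟩
    exact mem_pow_idealOfVars_of_isHomogeneous (hg i)
  rw [injective_iff_map_eq_zero]
  intro x hx
  ext1
  ext1 j
  exact eq_zero_of_isHomogeneous_of_mem_pow_idealOfVars
    (isHomogeneous_coeff_of_mem_imageCoordinateRing hg x.2 j)
    (coeff_mem_pow_of_mem_map_reesAlgebra hI (Ideal.Quotient.eq_zero_iff_mem.1 hx) j)

theorem toSpecialFiberRing_surjective (g : ι → MvPolynomial (Fin (n + 1)) k) :
    Function.Surjective (toSpecialFiberRing g) := by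
  intro y
  obtain ⟨⟨x, hx⟩, rfl⟩ := Ideal.Quotient.mk_surjective y
  change _ ∈ (toSpecialFiberRing g).range
  have hx' := hx
  rw [← adjoin_range_monomial_one_eq_reesAlgebra] at hx'
  induction hx' using Algebra.adjoin_induction with
  | mem x hx' =>
    obtain ⟨i, rfl⟩ := hx'
    exact ⟨⟨_, monomial_one_mem_imageCoordinateRing g i⟩, rfl⟩
  | algebraMap s =>
    refine ⟨algebraMap k _ (s.coeff 0), Eq.symm (Ideal.Quotient.eq.2 ?_)⟩
    have h := Ideal.mem_map_of_mem (algebraMap _ (reesAlgebra (Ideal.span (Set.range g))))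
      (sub_C_coeff_zero_mem_idealOfVars s)
    rwa [map_sub] at h
  | add x y hx₁ hy₁ ihx ihy =>
    rw [adjoin_range_monomial_one_eq_reesAlgebra] at hx₁ hy₁
    exact add_mem (ihx hx₁) (ihy hy₁)
  | mul x y hx₁ hy₁ ihx ihy =>
    rw [adjoin_range_monomial_one_eq_reesAlgebra] at hx₁ hy₁
    exact mul_mem (ihx hx₁) (ihy hy₁)

theorem analyticSpread_span_range {d : ℕ} {g : ι → MvPolynomial (Fin (n + 1)) k}
    (hg : ∀ i, (g i).IsHomogeneous d) :
    analyticSpread (Ideal.span (Set.range g)) = ringKrullDim (imageCoordinateRing k g) := by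
  let e : imageCoordinateRing k g ≃+* SpecialFiberRing (Ideal.span (Set.range g)) :=
    RingEquiv.ofBijective (toSpecialFiberRing g)
      ⟨toSpecialFiberRing_injective hg, toSpecialFiberRing_surjective g⟩
  exact (ringKrullDim_eq_of_ringEquiv e).symm

end SpecialFiberRing

section Syzygies

variable {σ k ι : Type*}

theorem homogeneousComponent_mul_of_isHomogeneous [CommSemiring k] {g : MvPolynomial σ k} {d : ℕ}
    (hg : g.IsHomogeneous d) (c : ℕ) (f : MvPolynomial σ k) :
    MvPolynomial.homogeneousComponent (c + d) (f * g) =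
      MvPolynomial.homogeneousComponent c f * g := by
  let _ := MvPolynomial.gradedAlgebra (σ := σ) (R := k)
  have hdecompose : ∀ (f : MvPolynomial σ k) (a : ℕ),
      (DirectSum.decompose (MvPolynomial.homogeneousSubmodule σ k) f a : MvPolynomial σ k) =
        MvPolynomial.homogeneousComponent a f := MvPolynomial.decomposition.decompose'_apply
  rw [← hdecompose, ← hdecompose]
  exact DirectSum.coe_decompose_mul_add_of_right_mem _ hg

theorem sum_range_homogeneousComponent [CommSemiring k] {f : MvPolynomial σ k} {N : ℕ}
    (hN : f.totalDegree < N) :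
    ∑ c ∈ Finset.range N, MvPolynomial.homogeneousComponent c f = f := by
  conv_rhs => rw [← MvPolynomial.sum_homogeneousComponent f]
  refine (Finset.sum_subset (Finset.range_mono hN) fun c _ hc => ?_).symm
  exact MvPolynomial.homogeneousComponent_eq_zero _ _ (by simpa using hc)

variable [CommRing k] [Fintype ι] {d : ℕ} {g : ι → MvPolynomial σ k}

theorem homogeneousComponent_mem_ker_linearCombination (hg : ∀ i, (g i).IsHomogeneous d)
    {v : ι → MvPolynomial σ k}
    (hv : v ∈ LinearMap.ker (Fintype.linearCombination (MvPolynomial σ k) g)) (c : ℕ) :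
    (fun i => MvPolynomial.homogeneousComponent c (v i)) ∈
      LinearMap.ker (Fintype.linearCombination (MvPolynomial σ k) g) := by
  rw [LinearMap.mem_ker, Fintype.linearCombination_apply] at hv ⊢
  simp only [smul_eq_mul, ← homogeneousComponent_mul_of_isHomogeneous (hg _)] at hv ⊢
  rw [← map_sum, hv, map_zero]

theorem span_homogeneous_syzygies_eq_ker (hg : ∀ i, (g i).IsHomogeneous d) :
    Submodule.span (MvPolynomial σ k)
      {v | v ∈ LinearMap.ker (Fintype.linearCombination (MvPolynomial σ k) g) ∧
        ∃ c, ∀ i, (v i).IsHomogeneous c} =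
      LinearMap.ker (Fintype.linearCombination (MvPolynomial σ k) g) := by
  refine le_antisymm (Submodule.span_le.2 fun v hv => hv.1) fun v hv => ?_
  let N := Finset.univ.sup fun i => (v i).totalDegree
  have hsum : ∑ c ∈ Finset.range (N + 1), (fun i => MvPolynomial.homogeneousComponent c (v i)) =
      v := by
    ext1 i
    rw [Finset.sum_apply]
    exact sum_range_homogeneousComponent
      (Nat.lt_succ_of_le (Finset.le_sup (f := fun i => (v i).totalDegree) (Finset.mem_univ i)))
  rw [← hsum]
  exact Submodule.sum_mem _ fun c _ => Submodule.subset_span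
    ⟨homogeneousComponent_mem_ker_linearCombination hg hv c, c, fun i =>
      MvPolynomial.homogeneousComponent_isHomogeneous c (v i)⟩

theorem exists_homogeneous_syzygy_matrix [Finite σ] [IsNoetherianRing k]
    (hg : ∀ i, (g i).IsHomogeneous d) :
    ∃ (s : ℕ) (A : Matrix ι (Fin s) (MvPolynomial σ k)) (e : Fin s → ℕ),
      (∀ i j, (A i j).IsHomogeneous (e j)) ∧
      LinearMap.range A.mulVecLin =
        LinearMap.ker (Fintype.linearCombination (MvPolynomial σ k) g) := by
  obtain ⟨t, ht, hspan⟩ := (Submodule.fg_span_iff_fg_span_finset_subset _).1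
    (IsNoetherian.noetherian (Submodule.span (MvPolynomial σ k)
      {v | v ∈ LinearMap.ker (Fintype.linearCombination (MvPolynomial σ k) g) ∧
        ∃ c, ∀ i, (v i).IsHomogeneous c}))
  obtain ⟨s, w, -, hw⟩ := t.finite_toSet.fin_param
  choose e he using fun j => (ht (hw ▸ Set.mem_range_self j : w j ∈ (t : Set _))).2
  refine ⟨s, (Matrix.of w).transpose, e, fun i j => he j i, ?_⟩
  rw [Matrix.range_mulVecLin, ← span_homogeneous_syzygies_eq_ker hg, hspan, ← hw]
  rfl

theorem exists_isHomogeneousPresentation {k : Type*} [Field k] [Finite σ]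
    {g : ι → MvPolynomial σ k} (hg : ∀ i, (g i).IsHomogeneous d)
    (hmin : ∀ i, g i ∉ Ideal.span (g '' {i}ᶜ)) :
    ∃ (s : ℕ) (A : Matrix ι (Fin s) (MvPolynomial σ k)),
      IsHomogeneousPresentation (Ideal.span (Set.range g)) g A := by
  obtain ⟨s, A, e, hAe, hA⟩ := exists_homogeneous_syzygy_matrix hg
  exact ⟨s, A, rfl, hmin, ⟨fun _ => d, fun j => d + e j, hg, fun i j =>
    Or.inr ⟨e j, rfl, hAe i j⟩⟩, hA⟩

end Syzygies

section DualBasis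

theorem exists_basis_coord_eq_of_separating {K V X : Type*} [Field K] [AddCommGroup V] [Module K V]
    [FiniteDimensional K V] {m : ℕ} (hm : Module.finrank K V = m) (f : X → Module.Dual K V)
    (hf : ∀ v, (∀ x, f x v = 0) → v = 0) :
    ∃ (b : Module.Basis (Fin m) K V) (p : Fin m → X), ∀ i, f (p i) = b.coord i := by
  have hspan : Submodule.span K (Set.range f) = ⊤ :=
    Submodule.span_eq_top_of_ne_zero fun v hv => by
      by_contra! h
      exact hv (hf v fun x => h _ ⟨x, rfl⟩)
  let c₀ := Module.Basis.ofSpan hspan.ge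
  let c : Module.Basis (Fin m) K (Module.Dual K V) := c₀.reindex
    (c₀.indexEquiv (Module.finBasisOfFinrankEq K _ (Subspace.dual_finrank_eq.trans hm)))
  have hc : ∀ i, c i ∈ Set.range f := fun i =>
    Module.Basis.ofSpan_subset hspan.ge ⟨_, (c₀.reindex_apply _ i).symm⟩
  choose p hp using hc
  let b := c.dualBasis.map (Module.evalEquiv K V).symm
  refine ⟨b, p, fun i => b.ext fun j => ?_⟩
  rw [b.coord_apply, b.repr_self, hp, Module.Basis.map_apply,
    Module.apply_evalEquiv_symm_apply, Module.Basis.dualBasis_apply_self, Finsupp.single_apply]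
  exact if_congr eq_comm rfl rfl

theorem span_image_compl_singleton_eq_ker_coord {R M ι : Type*} [Semiring R] [AddCommMonoid M]
    [Module R M] (b : Module.Basis ι R M) (i : ι) :
    Submodule.span R (b '' {i}ᶜ) = LinearMap.ker (b.coord i) := by
  ext x
  simp [b.mem_span_image]

end DualBasis

section Points

variable {σ k ι : Type*} [Field k]

theorem eq_zero_of_forall_eval_rep_eq_zero [Infinite k] [Nonempty σ] {f : MvPolynomial σ k} {d : ℕ}
    (hf : f.IsHomogeneous d)
    (h : ∀ p : Projectivization k (σ → k), MvPolynomial.eval p.rep f = 0) : f = 0 := by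
  refine MvPolynomial.funext_set (fun _ => {0}ᶜ) (fun _ => Set.infinite_of_finite_compl (by simp))
    fun v hv => ?_
  obtain ⟨i⟩ := ‹Nonempty σ›
  have hv₀ : v ≠ 0 := fun h₀ => hv i trivial (congrFun h₀ i)
  obtain ⟨a, ha⟩ := Projectivization.exists_smul_eq_mk_rep k v hv₀
  have hrep := h (Projectivization.mk k v hv₀)
  rw [← ha, Units.smul_def, eval_smul_of_isHomogeneous hf] at hrep
  simpa using hrep

variable {n : ℕ} {W : Submodule k (MvPolynomial (Fin (n + 1)) k)}
  {p : Projectivization k (Fin (n + 1) → k)}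

variable (W p) in
/-- Evaluation of the elements of `W` at the representative `p.rep` of the point `p`. The linear
form depends on the representative, its kernel `imagePoint W p` does not if `W` consists of forms
of the same degree. -/
noncomputable def evalAt : Module.Dual k W :=
  (MvPolynomial.aeval p.rep).toLinearMap.domRestrict W

theorem exists_basis_coord_eq_evalAt [Infinite k] {m d : ℕ} [FiniteDimensional k W]
    (hWd : W ≤ MvPolynomial.homogeneousSubmodule (Fin (n + 1)) k d)
    (hWm : Module.finrank k W = m) :
    ∃ (b : Module.Basis (Fin m) k W) (p : Fin m → Projectivization k (Fin (n + 1) → k)),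
      ∀ i, evalAt W (p i) = b.coord i :=
  exists_basis_coord_eq_of_separating hWm (evalAt W) fun f hf =>
    Subtype.ext (eq_zero_of_forall_eval_rep_eq_zero (hWd f.2) hf)

theorem rowPoint_eq_imagePoint {b : Module.Basis ι k W} {i : ι} (h : evalAt W p = b.coord i) :
    rowPoint b i = imagePoint W p :=
  calc rowPoint b i = (Submodule.span k (b '' {i}ᶜ)).map W.subtype := by
        rw [Submodule.map_span, Set.image_image]; rfl
    _ = (LinearMap.ker (evalAt W p)).map W.subtype := by
        rw [span_image_compl_singleton_eq_ker_coord, h]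
    _ = imagePoint W p := by
        rw [evalAt, LinearMap.ker_domRestrict, Submodule.map_comap_subtype]; rfl

theorem basis_mem_ker_eval_rep_iff {b : Module.Basis ι k W} {i : ι} (h : evalAt W p = b.coord i)
    (j : ι) :
    (b j : MvPolynomial (Fin (n + 1)) k) ∈ RingHom.ker (MvPolynomial.eval p.rep) ↔ j ≠ i := by
  classical
  have hj : MvPolynomial.eval p.rep (b j : MvPolynomial (Fin (n + 1)) k) = b.coord i (b j) :=
    LinearMap.congr_fun h (b j)
  simp [RingHom.mem_ker, hj, Finsupp.single_apply]

end Points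

theorem notMem_span_image_compl_singleton {S ι : Type*} [CommSemiring S] {g : ι → S} {P : Ideal S}
    {i : ι} (hP : ∀ j, g j ∈ P ↔ j ≠ i) : g i ∉ Ideal.span (g '' {i}ᶜ) := by
  have hle : Ideal.span (g '' {i}ᶜ) ≤ P := by
    rw [Ideal.span_le]
    rintro _ ⟨j, hj, rfl⟩
    exact (hP j).2 hj
  exact fun h => (hP i).1 (hle h) rfl

theorem ideal_span_range_basis {k S ι : Type*} [CommSemiring k] [CommSemiring S] [Algebra k S]
    {W : Submodule k S} (b : Module.Basis ι k W) :
    Ideal.span (Set.range fun i => (b i : S)) = Ideal.span (W : Set S) := by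
  have hW : Submodule.span k (Set.range fun i => (b i : S)) = W := by
    have h := Submodule.map_span W.subtype (Set.range b)
    rw [b.span_eq, Submodule.map_top, Submodule.range_subtype, ← Set.range_comp] at h
    exact h.symm
  conv_rhs => rw [← hW]
  exact (Submodule.span_span_of_tower k S _).symm

end RowIdeals

theorem mainTheorem8_general {k : Type*} [Field k] [Infinite k] (n r d : ℕ)
    (W : Submodule k (MvPolynomial (Fin (n + 1)) k))
    (hWd : W ≤ MvPolynomial.homogeneousSubmodule (Fin (n + 1)) k d)
    (hWr : Module.finrank k W = r + 1)
    (I : Ideal (MvPolynomial (Fin (n + 1)) k))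
    (hI : I = Ideal.span (W : Set (MvPolynomial (Fin (n + 1)) k))) :
    ∃ (b : Module.Basis (Fin (r + 1)) k W) (s : ℕ)
      (A : Matrix (Fin (r + 1)) (Fin s) (MvPolynomial (Fin (n + 1)) k)),
      RowIdeals.IsHomogeneousPresentation I
        (fun i => (b i : MvPolynomial (Fin (n + 1)) k)) A ∧
      (∀ i, ∃ p : Projectivization k (Fin (n + 1) → k),
        p ∉ RowIdeals.zeroLocus I ∧ RowIdeals.rowPoint b i = RowIdeals.imagePoint W p) ∧
      ∀ i, ((RowIdeals.rowIdeal A i).height : WithBot ℕ∞) + 1 ≤ RowIdeals.analyticSpread I := by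
  have : FiniteDimensional k W := Module.finite_of_finrank_pos (by lia)
  obtain ⟨b, p, hbp⟩ := RowIdeals.exists_basis_coord_eq_evalAt hWd hWr
  have hhom : ∀ i, (b i : MvPolynomial (Fin (n + 1)) k).IsHomogeneous d := fun i => hWd (b i).2
  have hker := fun i => RowIdeals.basis_mem_ker_eval_rep_iff (hbp i)
  have hspan := (RowIdeals.ideal_span_range_basis b).trans hI.symm
  obtain ⟨s, A, hA⟩ := RowIdeals.exists_isHomogeneousPresentation hhom fun i =>
    RowIdeals.notMem_span_image_compl_singleton (hker i)
  rw [hspan] at hA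
  refine ⟨b, s, A, hA, fun i => ⟨p i, fun hp => ?_, RowIdeals.rowPoint_eq_imagePoint (hbp i)⟩,
    fun i => ?_⟩
  · have hbI : (b i : MvPolynomial (Fin (n + 1)) k) ∈ I := hI ▸ Ideal.subset_span (b i).2
    exact (hker i i).1 (hp _ hbI) rfl
  · rw [← hspan, RowIdeals.analyticSpread_span_range hhom]
    have := RingHom.ker_isPrime (MvPolynomial.eval (p i).rep)
    exact RowIdeals.height_rowIdeal_add_one_le_ringKrullDim k hA.exact.le (hker i)

theorem mainTheorem8 {k : Type*} [Field k] [Infinite k] (n r d : ℕ)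
    (W : Submodule k (MvPolynomial (Fin (n + 1)) k))
    (hWd : W ≤ MvPolynomial.homogeneousSubmodule (Fin (n + 1)) k d)
    (hWr : Module.finrank k W = r + 1)
    (I : Ideal (MvPolynomial (Fin (n + 1)) k))
    (hI : I = Ideal.span (W : Set (MvPolynomial (Fin (n + 1)) k)))
    (hcodim : 2 ≤ I.height) :
    ∃ (b : Module.Basis (Fin (r + 1)) k W) (s : ℕ)
      (A : Matrix (Fin (r + 1)) (Fin s) (MvPolynomial (Fin (n + 1)) k)),
      RowIdeals.IsHomogeneousPresentation I
        (fun i => (b i : MvPolynomial (Fin (n + 1)) k)) A ∧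
      (∀ i, ∃ p : Projectivization k (Fin (n + 1) → k),
        p ∉ RowIdeals.zeroLocus I ∧ RowIdeals.rowPoint b i = RowIdeals.imagePoint W p) ∧
      ∀ i, ((RowIdeals.rowIdeal A i).height : WithBot ℕ∞) + 1 ≤ RowIdeals.analyticSpread I :=
  mainTheorem8_general n r d W hWd hWr I hI
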